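/- Let $K$ be a field that is complete with respect to a normalized discrete valuation $v_K\colon K\to\mathbb{Q}\cup\{\infty\}$ (normalized means $v_K(K^\times)=\mathbb{Z}$), with residue field $k$. A MacLane pseudovaluation is a map $v\colon K[x]\to\mathbb{Q}\cup\{\infty\}$ such that (a) $v(fg)=v(f)+v(g)$ and (b) $v(f+g)\ge\min(v(f),v(g))$ for all $f,g\in K[x]$; (c) $v|_K=v_K$; (d) $v(x)\ge 0$; (e) $v(K[x])\cap\mathbb{Q}=\frac1e\mathbb{Z}$ for some positive integer $e$; (f) if $v^{-1}(\infty)=\{0\}$, then the residue field of the extension of $v$ to $K(x)$ has transcendence degree one over $k$. Let $V(K[x])^*$ be the set of all MacLane pseudovaluations, partially ordered by $v\le w$ if and only if $v(f)\le w(f)$ for all $f\in K[x]$. Then: 1. For every $v\in V(K[x])^*$, the set $\{w\in V(K[x])^*\mid w\le v\}$ is totally ordered. 2. For all $v,w\in V(K[x])^*$, the set $\{u\in V(K[x])^*\mid u\le v,\ u\le w\}$ has a unique maximal element, denoted $\inf(v,w)$, and this is the greatest element of that set. 3. Let $V\subset V(K[x])^*$ be a finite nonempty subset that is inf-closed, i.e.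 $\inf(v,w)\in V$ for all $v,w\in V$. Then $V$ is a rooted tree, i.e. for every $v\in V$ the set $\{w\in V\mid w\le v\}$ is well ordered, and $V$ has a least element (the root). -/

import Mathlib

open scoped Polynomial

/-- An additive valuation on a field with values in `ℚ ∪ {∞}` is *normalized discrete* if its
value group (the set of values on nonzero elements) is exactly `ℤ`. -/
def IsNormalizedDiscrete {K : Type*} [Field K] (vK : AddValuation K (WithTop ℚ)) : Prop :=
  {γ : WithTop ℚ | ∃ a : K, a ≠ 0 ∧ vK a = γ} =
    Set.range (fun n : ℤ => (((n : ℚ) : ℚ) : WithTop ℚ))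

/-- `K` is complete with respect to `vK`: every sequence that is Cauchy for `vK` has a limit.
(The topology defined by `vK` is metrizable, so sequences suffice.) -/
def IsCompleteFor {K : Type*} [Field K] (vK : AddValuation K (WithTop ℚ)) : Prop :=
  ∀ a : ℕ → K,
    (∀ c : ℚ, ∃ N : ℕ, ∀ m ≥ N, ∀ n ≥ N, (c : WithTop ℚ) ≤ vK (a m - a n)) →
    ∃ l : K, ∀ c : ℚ, ∃ N : ℕ, ∀ n ≥ N, (c : WithTop ℚ) ≤ vK (a n - l)

section ResidueField

variable {K : Type*} [Field K]

theorem nonZeroDivisors_le_supp_primeCompl (v : AddValuation K[X] (WithTop ℚ))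
    (h0 : v.supp = ⊥) :
    nonZeroDivisors K[X] ≤ (AddValuation.toValuation v).supp.primeCompl := by
  intro f hf hmem
  have h : f ∈ v.supp := hmem
  rw [h0, Ideal.mem_bot] at h
  exact nonZeroDivisors.ne_zero hf h

/-- The unique extension to `K(x)` of an additive valuation `v` on `K[x]` with
`v⁻¹(∞) = (0)`, given by `v (f / g) = v f - v g`. -/
noncomputable def extendToRatFunc (v : AddValuation K[X] (WithTop ℚ)) (h0 : v.supp = ⊥) :
    Valuation (RatFunc K) (Multiplicative (WithTop ℚ)ᵒᵈ) :=
  (AddValuation.toValuation v).extendToLocalization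
    (nonZeroDivisors_le_supp_primeCompl v h0) (RatFunc K)

theorem hasExtension_extendToRatFunc (vK : AddValuation K (WithTop ℚ))
    (v : AddValuation K[X] (WithTop ℚ)) (hC : ∀ a : K, v (Polynomial.C a) = vK a)
    (h0 : v.supp = ⊥) :
    (AddValuation.toValuation vK).HasExtension (extendToRatFunc v h0) where
  val_isEquiv_comap := by
    have h : AddValuation.toValuation vK =
        (extendToRatFunc v h0).comap (algebraMap K (RatFunc K)) := by
      ext a
      rw [Valuation.comap_apply, IsScalarTower.algebraMap_apply K K[X] (RatFunc K) a,
        extendToRatFunc, Valuation.extendToLocalization_apply_map_apply,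
        AddValuation.toValuation_apply, AddValuation.toValuation_apply,
        ← Polynomial.C_eq_algebraMap, hC]
    exact Valuation.IsEquiv.of_eq h

/-- The transcendence degree of the residue field `k(v)` of (the extension to `K(x)` of) `v` over
the residue field `k` of `vK`. -/
noncomputable def residueTrdeg (vK : AddValuation K (WithTop ℚ))
    (v : AddValuation K[X] (WithTop ℚ)) (hC : ∀ a : K, v (Polynomial.C a) = vK a)
    (h0 : v.supp = ⊥) : Cardinal :=
  haveI := hasExtension_extendToRatFunc vK v hC h0
  Algebra.trdeg
    (IsLocalRing.ResidueField (AddValuation.toValuation vK).valuationSubring)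
    (IsLocalRing.ResidueField (extendToRatFunc v h0).valuationSubring)

end ResidueField

/-- MacLane pseudovaluations on `K[x]`. -/
structure MacLanePseudovaluation {K : Type*} [Field K] (vK : AddValuation K (WithTop ℚ)) where
  /-- the underlying map `K[x] → ℚ ∪ {∞}`, with `v (f * g) = v f + v g` and
  `min (v f) (v g) ≤ v (f + g)` -/
  val : AddValuation K[X] (WithTop ℚ)
  /-- `v` restricts to `vK` on constants -/
  map_C : ∀ a : K, val (Polynomial.C a) = vK a
  /-- `v x ≥ 0` -/
  map_X : 0 ≤ val Polynomial.X
  /-- `v` is discrete: the finite values form `(1/e) ℤ` for some positive integer `e` -/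
  discrete : ∃ e : ℕ, 0 < e ∧
    {q : ℚ | ∃ f : K[X], val f = (q : WithTop ℚ)} = Set.range (fun n : ℤ => (n : ℚ) / (e : ℚ))
  /-- if `v` takes the value `∞` at `0` only, then `k(v)` has transcendence degree one over `k` -/
  trdeg_eq_one : ∀ h0 : val.supp = ⊥, residueTrdeg vK val map_C h0 = 1

namespace MacLanePseudovaluation

variable {K : Type*} [Field K] {vK : AddValuation K (WithTop ℚ)}

theorem val_injective :
    Function.Injective (val : MacLanePseudovaluation vK → AddValuation K[X] (WithTop ℚ)) := by
  rintro ⟨v, _, _, _, _⟩ ⟨w, _, _, _, _⟩ h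
  cases h
  rfl

/-- The pointwise order: `v ≤ w` iff `v f ≤ w f` for all `f ∈ K[x]`. -/
instance : PartialOrder (MacLanePseudovaluation vK) where
  le v w := ∀ f : K[X], v.val f ≤ w.val f
  le_refl _ _ := le_rfl
  le_trans _ _ _ h₁ h₂ f := (h₁ f).trans (h₂ f)
  le_antisymm _ _ h₁ h₂ :=
    val_injective (AddValuation.ext fun f => le_antisymm (h₁ f) (h₂ f))

/-- The set of common lower bounds of `v` and `w`. -/
def commonLowerBounds (v w : MacLanePseudovaluation vK) : Set (MacLanePseudovaluation vK) :=
  {u | u ≤ v ∧ u ≤ w}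

/-- `u` is an infimum of `v` and `w`, i.e. a maximal element of the set of common lower bounds. -/
def IsInf (v w u : MacLanePseudovaluation vK) : Prop :=
  Maximal (fun u' => u' ∈ commonLowerBounds v w) u

/-- A set of MacLane pseudovaluations is inf-closed if it contains `inf(v, w)` whenever it
contains `v` and `w`. -/
def IsInfClosed (V : Set (MacLanePseudovaluation vK)) : Prop :=
  ∀ v ∈ V, ∀ w ∈ V, ∀ u, IsInf v w u → u ∈ V

end MacLanePseudovaluation

/-- A subset `V` of a partially ordered set is a *rooted tree* if for every `v ∈ V` the set
`{w ∈ V | w ≤ v}` is well ordered, and `V` has a least element (the root). -/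
structure IsRootedTree {P : Type*} [PartialOrder P] (V : Set P) : Prop where
  wellOrdered : ∀ v ∈ V, IsWellOrder {w : P // w ∈ V ∧ w ≤ v} (fun a b => a < b)
  exists_root : ∃ r, IsLeast V r

/-! Everything rests on φ-adic expansions, with φ a polynomial of least degree on which two
valuations differ. If `u ≤ v` and `u φ < v φ`, then in `a + φ * h` with `deg a < deg φ` the
`u`-leading parts cannot cancel: `v` keeps the value of `a` but strictly raises that of `φ * h`. So
`u` is the minimum over its φ-adic expansion, hence lies below every valuation that is at least `u`
in lower degrees and on φ. For two valuations below `v`, the one with the smaller value at the φ of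
smaller degree is therefore the smaller one (`AddValuation.le_total_of_le`).

For arbitrary `v ≠ w`, say `v φ < w φ`, the infimum is `adicMin v φ`. It is multiplicative because,
up to terms of larger value, each polynomial is `φ ^ n * g` with `adicMin v φ g = w g`, and `w` is
multiplicative (`exists_leading`, `adicMin_map_mul`). It is discrete because its values are values
of `v`. Its residue field has transcendence degree one because a power of φ, scaled to value zero,
has transcendental residue, while `K(x)` bounds the degree above.

In a finite inf-closed set a minimal element is least: its infimum with any other element cannot be
smaller. -/

/-! ### φ-adic expansions and comparison of valuations -/

section PhiAdic

variable {K : Type*} [Field K]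

/-- Induction along `φ`-adic expansions. -/
theorem Polynomial.adic_induction {φ : K[X]} (hφ : 0 < φ.degree) {P : K[X] → Prop} (zero : P 0)
    (step : ∀ a h : K[X], a.degree < φ.degree → P h → P (a + φ * h)) (f : K[X]) : P f := by
  have hφ0 : φ ≠ 0 := by rintro rfl; simp at hφ
  induction f using degree_lt_wf.induction with
  | _ f ih =>
    by_cases hf : f = 0
    · rwa [hf]
    · rw [← EuclideanDomain.mod_add_div f φ]
      exact step _ _ (EuclideanDomain.mod_lt f hφ0) (ih _ (degree_div_lt hf hφ))

theorem Polynomial.mod_div_add_mul {φ a : K[X]} (ha : a.degree < φ.degree) (h : K[X]) :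
    (a + φ * h) % φ = a ∧ (a + φ * h) / φ = h := by
  have hφ0 : φ ≠ 0 := by rintro rfl; simp at ha
  have hmod : (a + φ * h) % φ = a := by
    rw [add_mod, EuclideanDomain.mod_eq_zero.2 (dvd_mul_right φ h), add_zero,
      (mod_eq_self_iff hφ0).2 ha]
  refine ⟨hmod, ?_⟩
  have key := EuclideanDomain.mod_add_div (a + φ * h) φ
  rw [hmod] at key
  exact mul_left_cancel₀ hφ0 (add_left_cancel key)

/-- If `u ≤ w` and `w` agrees with `u` on `a` but not on `φ`, then the `φ`-adic remainder `a`
cannot cancel against a multiple of `φ` with respect to `u`. -/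
theorem AddValuation.map_add_mul_eq_min {u w : AddValuation K[X] (WithTop ℚ)}
    (hle : ∀ f, u f ≤ w f) {φ a : K[X]} (ha : u a = w a) (hφ : u φ < w φ) (h : K[X]) :
    u (a + φ * h) = min (u a) (u φ + u h) := by
  rw [← u.map_mul]
  by_cases heq : u a = u (φ * h)
  · refine le_antisymm ?_ (u.map_add _ _)
    rw [← heq, min_self]
    by_contra! hlt
    have hne : u h ≠ ⊤ := by
      intro htop
      rw [u.map_mul, htop, add_top] at heq
      rw [heq] at hlt
      exact not_top_lt hlt
    -- If the sum had larger `u`-value, then `a = (a + φ * h) - φ * h` would be a difference of two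
    -- terms of `w`-value above `u a = w a`.
    have h1 : u a < w (φ * h) := by
      rw [heq, u.map_mul, w.map_mul]
      exact (WithTop.add_lt_add_right hne hφ).trans_le (add_le_add_right (hle h) _)
    have h2 : u a < w ((a + φ * h) + -(φ * h)) :=
      w.map_lt_add (hlt.trans_le (hle _)) (by rwa [w.map_neg])
    rw [add_neg_cancel_right, ← ha] at h2
    exact lt_irrefl _ h2
  · exact u.map_add_of_distinct_val heq

/-- `u ≤ w` as soon as the `φ`-adic expansion computes `u` and `u ≤ w` on remainders and on
`φ`. -/
theorem AddValuation.le_of_adic {u : K[X] → WithTop ℚ} {φ : K[X]} (hφ : 0 < φ.degree)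
    (w : AddValuation K[X] (WithTop ℚ))
    (hu : ∀ a h : K[X], a.degree < φ.degree → u (a + φ * h) ≤ min (w a) (w φ + u h)) (f : K[X]) :
    u f ≤ w f := by
  induction f using Polynomial.adic_induction hφ with
  | zero => simp
  | step a h ha ih =>
    refine (hu a h ha).trans ?_
    refine (min_le_min_left _ ?_).trans (w.map_add _ _)
    rw [w.map_mul]
    exact add_le_add_right ih _

/-- A polynomial of minimal degree on which two functions differ. -/
theorem Polynomial.exists_min_degree {P : K[X] → Prop} (h : ∃ f, P f) :
    ∃ φ, P φ ∧ ∀ a : K[X], a.degree < φ.degree → ¬ P a := by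
  obtain ⟨φ, hφ, hmin⟩ := degree_lt_wf.has_min {f : K[X] | P f} h
  exact ⟨φ, hφ, fun a ha hP => hmin a hP ha⟩

/-- The valuations below a given one are totally ordered. -/
theorem AddValuation.le_total_of_le {vK : AddValuation K (WithTop ℚ)}
    {u₁ u₂ v : AddValuation K[X] (WithTop ℚ)}
    (hC₁ : ∀ a, u₁ (Polynomial.C a) = vK a) (hC₂ : ∀ a, u₂ (Polynomial.C a) = vK a)
    (hC : ∀ a, v (Polynomial.C a) = vK a)
    (h₁ : ∀ f, u₁ f ≤ v f) (h₂ : ∀ f, u₂ f ≤ v f) :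
    (∀ f, u₁ f ≤ u₂ f) ∨ (∀ f, u₂ f ≤ u₁ f) := by
  by_cases e₁ : ∃ f, u₁ f < v f
  swap
  · push Not at e₁
    exact .inr fun f => (h₂ f).trans (e₁ f)
  by_cases e₂ : ∃ f, u₂ f < v f
  swap
  · push Not at e₂
    exact .inl fun f => (h₁ f).trans (e₂ f)
  obtain ⟨φ₁, lt₁, min₁⟩ := Polynomial.exists_min_degree e₁
  obtain ⟨φ₂, lt₂, min₂⟩ := Polynomial.exists_min_degree e₂
  have pos {u : AddValuation K[X] (WithTop ℚ)} {φ : K[X]}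
      (hCu : ∀ a, u (Polynomial.C a) = vK a) (hu : u φ < v φ) :
      0 < φ.degree := by
    by_contra! hdeg
    rw [Polynomial.eq_C_of_degree_le_zero hdeg, hCu, hC] at hu
    exact lt_irrefl _ hu
  have main {u u' : AddValuation K[X] (WithTop ℚ)} {φ : K[X]} (hCu : ∀ a, u (Polynomial.C a) = vK a)
      (hu : ∀ f, u f ≤ v f) (hlt : u φ < v φ) (hmin : ∀ a : K[X], a.degree < φ.degree → ¬ u a < v a)
      (hmin' : ∀ a : K[X], a.degree < φ.degree → ¬ u' a < v a) (hφ : u φ ≤ u' φ) (f : K[X]) :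
      u f ≤ u' f := by
    refine AddValuation.le_of_adic (pos hCu hlt) u' (fun a h ha => ?_) f
    have hua : u a = v a := le_antisymm (hu a) (not_lt.1 (hmin a ha))
    rw [AddValuation.map_add_mul_eq_min hu hua hlt]
    exact min_le_min (hua.trans_le (not_lt.1 (hmin' a ha))) (add_le_add_left hφ _)
  rcases le_total φ₁.degree φ₂.degree with hd | hd
  · have hmin' := fun a (ha : a.degree < φ₁.degree) => min₂ a (ha.trans_le hd)
    rcases le_total (u₁ φ₁) (u₂ φ₁) with hφ | hφ
    · exact .inl (main hC₁ h₁ lt₁ min₁ hmin' hφ)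
    -- Here `u₂ φ₁ ≤ u₁ φ₁ < v φ₁`, so `φ₁` also has least degree for `u₂` and can replace `φ₂`.
    · exact .inr (main hC₂ h₂ (hφ.trans_lt lt₁) hmin' min₁ hφ)
  · have hmin' := fun a (ha : a.degree < φ₂.degree) => min₁ a (ha.trans_le hd)
    rcases le_total (u₂ φ₂) (u₁ φ₂) with hφ | hφ
    · exact .inr (main hC₂ h₂ lt₂ min₂ hmin' hφ)
    · exact .inl (main hC₁ h₁ (hφ.trans_lt lt₂) hmin' min₂ hφ)

end PhiAdic

/-! ### Construction of the infimum -/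

section Augment

variable {K : Type*} [Field K]

/-- `v` and `w` agree in degrees below that of `φ`, and `v φ < w φ`. -/
structure IsSeparating (v w : AddValuation K[X] (WithTop ℚ)) (φ : K[X]) : Prop where
  degree_pos : 0 < φ.degree
  eq_of_degree_lt : ∀ a : K[X], a.degree < φ.degree → v a = w a
  lt : v φ < w φ

open Classical in
/-- The function `∑ fᵢ φⁱ ↦ minᵢ (v fᵢ + i • v φ)` on `φ`-adic expansions. -/
noncomputable def adicMin (v : AddValuation K[X] (WithTop ℚ)) (φ f : K[X]) : WithTop ℚ :=
  if _h : 0 < φ.degree ∧ f ≠ 0 then min (v (f % φ)) (v φ + adicMin v φ (f / φ)) else ⊤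
termination_by f.degree
decreasing_by exact Polynomial.degree_div_lt _h.2 _h.1

variable {v w : AddValuation K[X] (WithTop ℚ)} {φ : K[X]}

theorem adicMin_zero : adicMin v φ 0 = ⊤ := by
  rw [adicMin]
  simp

theorem adicMin_add_mul (hφ : 0 < φ.degree) {a : K[X]} (ha : a.degree < φ.degree) (h : K[X]) :
    adicMin v φ (a + φ * h) = min (v a) (v φ + adicMin v φ h) := by
  obtain ⟨hmod, hdiv⟩ := Polynomial.mod_div_add_mul ha h
  by_cases h0 : a + φ * h = 0
  · rw [h0] at hmod hdiv
    have ha0 : a = 0 := by rw [← hmod, EuclideanDomain.zero_mod]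
    have hh0 : h = 0 := by rw [← hdiv, EuclideanDomain.zero_div]
    simp [ha0, hh0, adicMin_zero]
  · rw [adicMin, dif_pos ⟨hφ, h0⟩, hmod, hdiv]

theorem adicMin_of_degree_lt (hφ : 0 < φ.degree) {a : K[X]} (ha : a.degree < φ.degree) :
    adicMin v φ a = v a := by
  have := adicMin_add_mul (v := v) hφ ha 0
  rwa [mul_zero, add_zero, adicMin_zero, add_top, min_top_right] at this

theorem adicMin_mul (hφ : 0 < φ.degree) (h : K[X]) :
    adicMin v φ (φ * h) = v φ + adicMin v φ h := by
  have := adicMin_add_mul (v := v) (a := 0) hφ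
    (by rw [Polynomial.degree_zero]; exact bot_lt_of_lt hφ) h
  rwa [zero_add, v.map_zero, min_top_left] at this

theorem adicMin_pow_mul (hφ : 0 < φ.degree) (n : ℕ) (h : K[X]) :
    adicMin v φ (φ ^ n * h) = n • v φ + adicMin v φ h := by
  induction n with
  | zero => simp
  | succ n ih => rw [pow_succ', mul_assoc, adicMin_mul hφ, ih, succ_nsmul', add_assoc]

/-- The source of both bounds `adicMin v φ ≤ v` and `adicMin v φ ≤ w`. -/
theorem adicMin_le (hφ : 0 < φ.degree) {w : AddValuation K[X] (WithTop ℚ)}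
    (hle : ∀ a : K[X], a.degree < φ.degree → v a ≤ w a) (hφw : v φ ≤ w φ) (f : K[X]) :
    adicMin v φ f ≤ w f := by
  refine AddValuation.le_of_adic hφ w (fun a h ha => ?_) f
  rw [adicMin_add_mul hφ ha]
  exact min_le_min (hle a ha) (add_le_add_left hφw _)

theorem min_le_adicMin_add (hφ : 0 < φ.degree) (f : K[X]) :
    ∀ g, min (adicMin v φ f) (adicMin v φ g) ≤ adicMin v φ (f + g) := by
  induction f using Polynomial.adic_induction hφ with
  | zero => simp
  | step a h ha ih =>
    intro g
    rw [← EuclideanDomain.mod_add_div g φ]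
    have hφ0 : φ ≠ 0 := by rintro rfl; simp at hφ
    have hb := EuclideanDomain.mod_lt g hφ0
    generalize g % φ = b at *
    generalize g / φ = k
    have hab : (a + b).degree < φ.degree :=
      (Polynomial.degree_add_le _ _).trans_lt (max_lt ha hb)
    rw [show a + φ * h + (b + φ * k) = (a + b) + φ * (h + k) by ring, adicMin_add_mul hφ ha,
      adicMin_add_mul hφ hb, adicMin_add_mul hφ hab]
    refine le_min ?_ ?_
    · exact (le_min ((min_le_left _ _).trans (min_le_left _ _))
        ((min_le_right _ _).trans (min_le_left _ _))).trans (v.map_add a b)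
    · refine le_trans ?_ (add_le_add_right (ih k) _)
      rw [← min_add_add_left]
      exact min_le_min (min_le_right _ _) (min_le_right _ _)

theorem lt_adicMin_add (hφ : 0 < φ.degree) {f g : K[X]} {γ : WithTop ℚ}
    (hf : γ < adicMin v φ f) (hg : γ < adicMin v φ g) : γ < adicMin v φ (f + g) :=
  (lt_min hf hg).trans_le (min_le_adicMin_add hφ f g)

theorem le_adicMin_add (hφ : 0 < φ.degree) {f g : K[X]} {γ : WithTop ℚ}
    (hf : γ ≤ adicMin v φ f) (hg : γ ≤ adicMin v φ g) : γ ≤ adicMin v φ (f + g) :=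
  (le_min hf hg).trans (min_le_adicMin_add hφ f g)

/-- Every value of `adicMin v φ` is a value of `v`. -/
theorem adicMin_eq_map (hφ : 0 < φ.degree) (f : K[X]) : ∃ g, adicMin v φ f = v g := by
  induction f using Polynomial.adic_induction hφ with
  | zero => exact ⟨0, by rw [adicMin_zero, v.map_zero]⟩
  | step a h ha ih =>
    obtain ⟨g, hg⟩ := ih
    rw [adicMin_add_mul hφ ha, hg, ← v.map_mul]
    rcases min_choice (v a) (v (φ * g)) with h | h <;> exact ⟨_, h⟩

namespace IsSeparating

theorem adicMin_le_left (H : IsSeparating v w φ) (f : K[X]) : adicMin v φ f ≤ v f :=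
  adicMin_le H.degree_pos (fun _ _ => le_rfl) le_rfl f

theorem adicMin_le_right (H : IsSeparating v w φ) (f : K[X]) : adicMin v φ f ≤ w f :=
  adicMin_le H.degree_pos (fun a ha => (H.eq_of_degree_lt a ha).le) H.lt.le f

/-- The only case of supermultiplicativity where `w` is needed; `le_adicMin_mul` follows by
expanding both factors. -/
theorem le_adicMin_mul_of_degree_lt (H : IsSeparating v w φ) {a b : K[X]}
    (ha : a.degree < φ.degree) (hb : b.degree < φ.degree) :
    v a + v b ≤ adicMin v φ (a * b) := by
  have hφ0 : φ ≠ 0 := by rintro rfl; simpa using H.degree_pos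
  rcases eq_or_ne a 0 with rfl | ha0
  · simp [adicMin_zero]
  have hr := EuclideanDomain.mod_lt (a * b) hφ0
  -- Since `deg (a * b) < 2 * deg φ`, the expansion of the product has only two terms.
  have hq : (a * b / φ).degree < φ.degree := by
    rcases eq_or_ne b 0 with rfl | hb0
    · simpa using bot_lt_of_lt H.degree_pos
    · by_contra! hle
      have h1 : φ.degree + (a * b / φ).degree = (a * b).degree := by
        refine Polynomial.degree_add_div hφ0 ?_
        by_contra! hlt
        rw [(Polynomial.div_eq_zero_iff hφ0).2 hlt, Polynomial.degree_zero] at hle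
        exact absurd H.degree_pos (by simp [le_bot_iff.1 hle])
      rw [Polynomial.degree_mul, Polynomial.degree_eq_natDegree hφ0,
        Polynomial.degree_eq_natDegree ha0, Polynomial.degree_eq_natDegree hb0] at h1
      rw [Polynomial.degree_eq_natDegree hφ0, Polynomial.degree_eq_natDegree ha0] at ha
      rw [Polynomial.degree_eq_natDegree hφ0, Polynomial.degree_eq_natDegree hb0] at hb
      rw [Polynomial.degree_eq_natDegree hφ0] at hle
      have hq0 : a * b / φ ≠ 0 := by
        intro h0
        rw [h0, Polynomial.degree_zero] at hle
        exact absurd hle (by simp)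
      rw [Polynomial.degree_eq_natDegree hq0] at h1 hle
      norm_cast at *
      omega
  have hab : v (a * b) = w (a * b) := by
    rw [v.map_mul, w.map_mul, H.eq_of_degree_lt a ha, H.eq_of_degree_lt b hb]
  have key := EuclideanDomain.mod_add_div (a * b) φ
  rw [← v.map_mul]
  generalize a * b = c at *
  generalize c % φ = r at *
  generalize c / φ = q at *
  rw [← key, adicMin_add_mul H.degree_pos hr, adicMin_of_degree_lt H.degree_pos hq, key]
  -- Otherwise `r` and `φ * q` cancel for `v`, so `v r = v (φ * q)`. But `w r = v r < w (φ * q)`, so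
  -- there is no cancellation for `w`, and `w c = w r < v c`, contradicting `v c = w c`.
  have hqc : v c ≤ v φ + v q := by
    by_contra! hlt
    have hq_ne : v q ≠ ⊤ := by
      intro h
      rw [h, add_top] at hlt
      exact not_top_lt hlt
    have hlt_w : v φ + v q < w (φ * q) := by
      rw [w.map_mul, ← H.eq_of_degree_lt q hq]
      exact WithTop.add_lt_add_right hq_ne H.lt
    have hvr : v r = v φ + v q := by
      rw [← v.map_mul] at hlt ⊢
      rw [eq_sub_of_add_eq key, v.map_sub_eq_of_lt_right hlt]
    have hwr : w r = v φ + v q := by rw [← H.eq_of_degree_lt r hr, hvr]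
    rw [← hwr] at hlt hlt_w
    rw [hab, ← key, w.map_add_eq_of_lt_left hlt_w] at hlt
    exact lt_irrefl _ hlt
  refine le_min ?_ hqc
  rw [eq_sub_of_add_eq key]
  exact v.map_le_sub le_rfl (by rwa [v.map_mul])

theorem le_adicMin_mul (H : IsSeparating v w φ) (f g : K[X]) :
    adicMin v φ f + adicMin v φ g ≤ adicMin v φ (f * g) := by
  have hsmall (a : K[X]) (ha : a.degree < φ.degree) :
      v a + adicMin v φ g ≤ adicMin v φ (a * g) := by
    induction g using Polynomial.adic_induction H.degree_pos with
    | zero => simp [adicMin_zero]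
    | step b k hb ih =>
      rw [show a * (b + φ * k) = a * b + φ * (a * k) by ring]
      refine le_adicMin_add H.degree_pos ?_ ?_
      · refine le_trans ?_ (H.le_adicMin_mul_of_degree_lt ha hb)
        rw [adicMin_add_mul H.degree_pos hb]
        exact add_le_add_right (min_le_left _ _) _
      · rw [adicMin_mul H.degree_pos, adicMin_add_mul H.degree_pos hb]
        refine (add_le_add_right (min_le_right _ _) _).trans ?_
        rw [add_left_comm]
        exact add_le_add_right ih _
  induction f using Polynomial.adic_induction H.degree_pos with
  | zero => simp [adicMin_zero]
  | step a h ha ih =>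
    rw [adicMin_add_mul H.degree_pos ha, add_mul, mul_assoc]
    refine le_adicMin_add H.degree_pos ?_ ?_
    · exact (add_le_add_left (min_le_left _ _) _).trans (hsmall a ha)
    · rw [adicMin_mul H.degree_pos]
      refine (add_le_add_left (min_le_right _ _) _).trans ?_
      rw [add_assoc]
      exact add_le_add_right ih _

/-- Up to terms of larger value, every polynomial is a power of `φ` times a polynomial on which
`adicMin v φ` and `w` agree. -/
theorem exists_leading (H : IsSeparating v w φ) (f : K[X]) (hf : adicMin v φ f ≠ ⊤) :
    ∃ (p : K[X]) (n : ℕ) (g : K[X]), f = p + φ ^ n * g ∧ adicMin v φ f < adicMin v φ p ∧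
      adicMin v φ g = w g := by
  induction f using Polynomial.adic_induction H.degree_pos with
  | zero => exact absurd adicMin_zero hf
  | step a h ha ih =>
    have hrec := adicMin_add_mul (v := v) H.degree_pos ha h
    rcases le_or_gt (v a) (v φ + adicMin v φ h) with hle | hlt
    -- The remainder already attains the minimum, and passing to `w` pushes the tail strictly above
    -- it.
    · refine ⟨0, 0, a + φ * h, by simp, by rw [adicMin_zero]; exact lt_top_iff_ne_top.2 hf, ?_⟩
      rw [min_eq_left hle] at hrec
      have ha_ne : v a ≠ ⊤ := by rwa [hrec] at hf
      rw [hrec, H.eq_of_degree_lt a ha, w.map_add_eq_of_lt_left]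
      rw [← H.eq_of_degree_lt a ha, w.map_mul]
      by_cases hw : w h = ⊤
      · rw [hw, add_top]
        exact lt_top_iff_ne_top.2 ha_ne
      · exact (hle.trans (add_le_add_right (H.adicMin_le_right h) _)).trans_lt
          (WithTop.add_lt_add_right hw H.lt)
    · rw [min_eq_right hlt.le] at hrec
      have hh : adicMin v φ h ≠ ⊤ := by
        intro h
        rw [h, add_top] at hlt
        exact not_top_lt hlt
      obtain ⟨p, n, g, hpg, hlt', hg⟩ := ih hh
      refine ⟨a + φ * p, n + 1, g, ?_, ?_, hg⟩
      · conv_lhs => rw [hpg]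
        ring
      · rw [hrec, adicMin_add_mul H.degree_pos ha]
        exact lt_min hlt (WithTop.add_lt_add_left H.lt.ne_top hlt')

theorem adicMin_map_mul (H : IsSeparating v w φ) (f g : K[X]) :
    adicMin v φ (f * g) = adicMin v φ f + adicMin v φ g := by
  have hd := H.degree_pos
  refine le_antisymm ?_ (H.le_adicMin_mul f g)
  by_cases hf : adicMin v φ f = ⊤
  · simp [hf]
  by_cases hg : adicMin v φ g = ⊤
  · simp [hg]
  obtain ⟨p, m, f', hf', hp, hfw⟩ := H.exists_leading f hf
  obtain ⟨q, n, g', hg', hq, hgw⟩ := H.exists_leading g hg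
  -- `adicMin v φ` is not yet known to be a valuation, so signs are handled through the constant
  -- `-1`.
  have hneg (h : K[X]) : adicMin v φ h ≤ adicMin v φ (-h) := by
    have := H.le_adicMin_mul (-1) h
    rwa [neg_one_mul, adicMin_of_degree_lt hd (by simpa using hd), v.map_neg, v.map_one,
      zero_add] at this
  have hpf : adicMin v φ f = m • v φ + w f' := by
    rw [← hfw, ← adicMin_pow_mul hd]
    refine le_antisymm ?_ ?_
    · rw [show φ ^ m * f' = f + -p by rw [hf']; ring]
      exact le_adicMin_add hd le_rfl (hp.le.trans (hneg p))
    · by_contra! hlt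
      have := lt_adicMin_add hd hp hlt
      rw [← hf'] at this
      exact lt_irrefl _ this
  have hqg : adicMin v φ g = n • v φ + w g' := by
    rw [← hgw, ← adicMin_pow_mul hd]
    refine le_antisymm ?_ ?_
    · rw [show φ ^ n * g' = g + -q by rw [hg']; ring]
      exact le_adicMin_add hd le_rfl (hq.le.trans (hneg q))
    · by_contra! hlt
      have := lt_adicMin_add hd hq hlt
      rw [← hg'] at this
      exact lt_irrefl _ this
  by_contra! hlt
  -- Multiplicativity of `w` bounds the leading product. It equals `f * g - p * g - φ ^ m * f' * q`,
  -- whose three terms would all have larger value if the claim failed.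
  have hlead : adicMin v φ (φ ^ (m + n) * (f' * g')) ≤ adicMin v φ f + adicMin v φ g := by
    rw [adicMin_pow_mul hd, hpf, hqg, add_nsmul, add_add_add_comm, ← w.map_mul]
    exact add_le_add_right (H.adicMin_le_right _) _
  have h1 : adicMin v φ f + adicMin v φ g < adicMin v φ (p * g) :=
    (WithTop.add_lt_add_right hg hp).trans_le (H.le_adicMin_mul p g)
  have h2 : adicMin v φ f + adicMin v φ g < adicMin v φ (φ ^ m * f' * q) := by
    refine lt_of_lt_of_le ?_ (H.le_adicMin_mul _ q)
    rw [adicMin_pow_mul hd, hfw, ← hpf]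
    exact WithTop.add_lt_add_left hf hq
  have h3 := lt_adicMin_add hd (lt_adicMin_add hd hlt (h1.trans_le (hneg _))) (h2.trans_le (hneg _))
  refine absurd h3 (not_lt.2 (le_trans (le_of_eq ?_) hlead))
  congr 1
  rw [hf', hg']
  ring

/-- The valuation `adicMin v φ`. -/
noncomputable def inf (H : IsSeparating v w φ) : AddValuation K[X] (WithTop ℚ) :=
  AddValuation.of (adicMin v φ) adicMin_zero
    (by rw [adicMin_of_degree_lt H.degree_pos (by simpa using H.degree_pos), v.map_one])
    (min_le_adicMin_add H.degree_pos) H.adicMin_map_mul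

theorem inf_apply (H : IsSeparating v w φ) (f : K[X]) : H.inf f = adicMin v φ f := rfl

theorem inf_le_left (H : IsSeparating v w φ) (f : K[X]) : H.inf f ≤ v f := H.adicMin_le_left f

theorem inf_le_right (H : IsSeparating v w φ) (f : K[X]) : H.inf f ≤ w f := H.adicMin_le_right f

theorem inf_add_mul (H : IsSeparating v w φ) {a : K[X]} (ha : a.degree < φ.degree) (h : K[X]) :
    H.inf (a + φ * h) = min (v a) (v φ + H.inf h) :=
  adicMin_add_mul H.degree_pos ha h

theorem inf_of_degree_lt (H : IsSeparating v w φ) {a : K[X]} (ha : a.degree < φ.degree) :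
    H.inf a = v a :=
  adicMin_of_degree_lt H.degree_pos ha

theorem inf_self (H : IsSeparating v w φ) : H.inf φ = v φ := by
  have := adicMin_mul (v := v) H.degree_pos 1
  rwa [mul_one, ← H.inf_apply 1, H.inf.map_one, add_zero] at this

theorem exists_inf_eq (H : IsSeparating v w φ) (f : K[X]) : ∃ g, H.inf f = v g :=
  adicMin_eq_map H.degree_pos f

theorem inf_C (H : IsSeparating v w φ) (a : K) : H.inf (Polynomial.C a) = v (Polynomial.C a) :=
  H.inf_of_degree_lt (Polynomial.degree_C_le.trans_lt H.degree_pos)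

theorem le_inf (H : IsSeparating v w φ) {u : AddValuation K[X] (WithTop ℚ)}
    (hC : ∀ a, u (Polynomial.C a) = v (Polynomial.C a))
    (hv : ∀ f, u f ≤ v f) (hw : ∀ f, u f ≤ w f) : ∀ f, u f ≤ H.inf f := by
  rcases AddValuation.le_total_of_le (vK := v.comap Polynomial.C) hC H.inf_C (fun _ => rfl) hv
    H.inf_le_left with hle | hge
  · exact hle
  -- If `H.inf ≤ u ≤ v`, then `u` agrees with `v` and `w` below `deg φ`, and `u φ ≤ v φ < w φ`; so
  -- the φ-adic expansion computes `u` as well.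
  · refine AddValuation.le_of_adic H.degree_pos H.inf fun a h ha => ?_
    have hua : u a = v a := le_antisymm (hv a) ((H.inf_of_degree_lt ha).symm.trans_le (hge a))
    rw [AddValuation.map_add_mul_eq_min hw (hua.trans (H.eq_of_degree_lt a ha))
      ((hv φ).trans_lt H.lt), H.inf_of_degree_lt ha, H.inf_self]
    exact min_le_min hua.le (add_le_add_left (hv φ) _)

end IsSeparating

theorem IsSeparating.exists_of_ne {v w : AddValuation K[X] (WithTop ℚ)} (hne : v ≠ w)
    (hC : ∀ a, v (Polynomial.C a) = w (Polynomial.C a)) :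
    ∃ φ, IsSeparating v w φ ∨ IsSeparating w v φ := by
  have hex : ∃ f, v f ≠ w f := by
    by_contra! h
    exact hne (AddValuation.ext h)
  obtain ⟨φ, hφ, hmin⟩ := Polynomial.exists_min_degree hex
  have hpos : 0 < φ.degree := by
    by_contra! hdeg
    rw [Polynomial.eq_C_of_degree_le_zero hdeg] at hφ
    exact hφ (hC _)
  refine ⟨φ, hφ.lt_or_gt.imp (fun h => ⟨hpos, fun a ha => not_not.1 (hmin a ha), h⟩)
    fun h => ⟨hpos, fun a ha => (not_not.1 (hmin a ha)).symm, h⟩⟩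

end Augment

/-! ### Transcendence degree of residue fields -/

section ResidueTrdeg

open IsLocalRing

/-- Lifts of algebraically independent residues are algebraically independent. -/
theorem Valuation.algebraicIndependent_of_residue {ι K L Γ₀ Γ₁ : Type*} [Field K] [Field L]
    [Algebra K L] [LinearOrderedCommGroupWithZero Γ₀] [LinearOrderedCommGroupWithZero Γ₁]
    (vK : Valuation K Γ₀) (vL : Valuation L Γ₁) [vK.HasExtension vL] {y : ι → vL.valuationSubring}
    (hy : AlgebraicIndependent (ResidueField vK.valuationSubring)
      fun i => residue vL.valuationSubring (y i)) :
    AlgebraicIndependent K fun i => (y i : L) := by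
  rw [algebraicIndependent_iff] at hy ⊢
  intro P hP
  by_contra hP0
  -- Dividing a relation by a coefficient of largest multiplicative value makes it integral with one
  -- coefficient equal to 1, so its reduction is a nontrivial relation.
  obtain ⟨m, hm, hmax⟩ := P.support.exists_max_image (fun n => vK (P.coeff n))
    (Finset.nonempty_of_ne_empty (by simpa using hP0))
  have hc : P.coeff m ≠ 0 := MvPolynomial.mem_support_iff.1 hm
  have hmem : MvPolynomial.C (P.coeff m)⁻¹ * P ∈
      Set.range (MvPolynomial.map (σ := ι) (algebraMap vK.valuationSubring K)) := by
    rw [MvPolynomial.mem_range_map_iff_coeffs_subset]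
    intro c hcoef
    obtain ⟨n, -, rfl⟩ := MvPolynomial.mem_coeffs_iff.1 (Finset.mem_coe.1 hcoef)
    refine ⟨⟨_, ?_⟩, rfl⟩
    change vK (MvPolynomial.coeff n (MvPolynomial.C (P.coeff m)⁻¹ * P)) ≤ 1
    rw [MvPolynomial.coeff_C_mul, map_mul, map_inv₀]
    have hle : vK (P.coeff n) ≤ vK (P.coeff m) := by
      by_cases hn : n ∈ P.support
      · exact hmax n hn
      · rw [MvPolynomial.notMem_support_iff.1 hn, map_zero]
        exact zero_le
    exact (mul_le_mul_right hle _).trans (inv_mul_cancel₀ (by simpa using hc)).le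
  obtain ⟨Q, hQ⟩ := hmem
  have hQm : Q.coeff m = 1 := by
    apply Subtype.val_injective
    have := congrArg (MvPolynomial.coeff m) hQ
    rw [MvPolynomial.coeff_map, MvPolynomial.coeff_C_mul, inv_mul_cancel₀ hc] at this
    exact this
  have hQy : MvPolynomial.aeval y Q = 0 := by
    apply Subtype.val_injective
    have h1 := MvPolynomial.aeval_algebraMap_apply L y Q
    have h2 := MvPolynomial.aeval_map_algebraMap K (fun i => (y i : L)) Q
    rw [hQ, map_mul, hP, mul_zero] at h2
    exact h1.symm.trans h2.symm
  have hres : MvPolynomial.aeval (fun i => residue vL.valuationSubring (y i))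
      (MvPolynomial.map (residue vK.valuationSubring) Q) = 0 := by
    have h1 := congrArg (residue vL.valuationSubring) hQy
    rw [map_zero] at h1
    rw [← h1, MvPolynomial.aeval_def, MvPolynomial.aeval_def, MvPolynomial.eval₂_map,
      MvPolynomial.hom_eval₂]
    rfl
  have h0 := congrArg (MvPolynomial.coeff m) (hy _ hres)
  rw [MvPolynomial.coeff_map, hQm, map_one, MvPolynomial.coeff_zero] at h0
  exact one_ne_zero h0

theorem Valuation.trdeg_residueField_le {K Γ₀ Γ₁ : Type*} {L : Type*} [Field K] [Field L]
    [Algebra K L] [LinearOrderedCommGroupWithZero Γ₀] [LinearOrderedCommGroupWithZero Γ₁]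
    (vK : Valuation K Γ₀) (vL : Valuation L Γ₁) [vK.HasExtension vL] :
    Algebra.trdeg (ResidueField vK.valuationSubring) (ResidueField vL.valuationSubring) ≤
      Algebra.trdeg K L := by
  refine ciSup_le' fun s => ?_
  choose y hy using fun i : s.1 => residue_surjective (R := vL.valuationSubring) i.1
  have hind : AlgebraicIndependent (ResidueField vK.valuationSubring)
      fun i => residue vL.valuationSubring (y i) := by
    simp only [hy]
    exact s.2
  exact (Valuation.algebraicIndependent_of_residue vK vL hind).cardinalMk_le_trdeg

theorem RatFunc.trdeg_eq_one (K : Type*) [Field K] : Algebra.trdeg K (RatFunc K) = 1 := by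
  have : Algebra.IsAlgebraic K[X] (RatFunc K) := IsLocalization.isAlgebraic _ (nonZeroDivisors K[X])
  rw [← trdeg_add_eq K K[X] (A := RatFunc K), Polynomial.trdeg_of_isDomain,
    trdeg_eq_zero, add_zero]

/-- A residue `t̄` is transcendental if `a + t * g` is a unit for every unit `a` of the base and
every polynomial `g` in `t`. -/
theorem Valuation.transcendental_residue {K L Γ₀ Γ₁ : Type*} [Field K] [Field L]
    [Algebra K L] [LinearOrderedCommGroupWithZero Γ₀] [LinearOrderedCommGroupWithZero Γ₁]
    (vK : Valuation K Γ₀) (vL : Valuation L Γ₁) [vK.HasExtension vL] (t : vL.valuationSubring)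
    (ht : vL t = 1)
    (h : ∀ (a : K) (P : K[X]), vK a = 1 →
      1 ≤ vL (algebraMap K L a + t * Polynomial.aeval (t : L) P)) :
    Transcendental (ResidueField vK.valuationSubring) (residue vL.valuationSubring t) := by
  intro halg
  have ht0 : residue vL.valuationSubring t ≠ 0 := by
    rw [Ne, residue_eq_zero_iff, Valuation.mem_maximalIdeal_iff, ht]
    exact lt_irrefl _
  have hcoeff := minpoly.coeff_zero_ne_zero halg.isIntegral ht0
  -- Lift the minimal polynomial. Its constant term is nonzero because the residue of `t` is, so `Q`
  -- has a unit constant term, although `Q` at `t` is not a unit.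
  obtain ⟨Q, hQ⟩ := Polynomial.map_surjective (residue vK.valuationSubring) residue_surjective
    (minpoly (ResidueField vK.valuationSubring) (residue vL.valuationSubring t))
  have hmem : residue vL.valuationSubring (Polynomial.aeval t Q) = 0 := by
    rw [← minpoly.aeval (ResidueField vK.valuationSubring) (residue vL.valuationSubring t), ← hQ,
      Polynomial.aeval_def, Polynomial.aeval_def, Polynomial.eval₂_map, Polynomial.hom_eval₂]
    rfl
  rw [residue_eq_zero_iff, Valuation.mem_maximalIdeal_iff] at hmem
  rw [← hQ, Polynomial.coeff_map, Ne, residue_eq_zero_iff, Valuation.mem_maximalIdeal_iff,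
    not_lt] at hcoeff
  have hunit : vK (Q.coeff 0 : K) = 1 := le_antisymm (Q.coeff 0).2 hcoeff
  have hval : ((Polynomial.aeval t Q : vL.valuationSubring) : L) =
      algebraMap K L (Q.coeff 0) +
        t * Polynomial.aeval (t : L) (Q.divX.map (algebraMap vK.valuationSubring K)) := by
    conv_lhs => rw [← Polynomial.divX_mul_X_add Q]
    rw [Polynomial.aeval_map_algebraMap, map_add, map_mul, Polynomial.aeval_X,
      Polynomial.aeval_C, add_comm, mul_comm]
    have := Polynomial.aeval_algebraMap_apply L t Q.divX
    change _ + (t : L) * _ = _ + (t : L) * _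
    exact congrArg (_ + (t : L) * ·) this.symm
  rw [hval] at hmem
  exact not_lt.2 (h _ _ hunit) hmem

end ResidueTrdeg

/-! ### Discreteness of the value group -/

section Discrete

/-- A submonoid of `(1/e) ℤ` that contains `ℤ` is of the form `(1/d) ℤ`. -/
theorem exists_eq_range_div {S : Set ℚ} {e : ℕ} (he : 0 < e)
    (hS : S ⊆ Set.range fun n : ℤ => (n : ℚ) / e) (hint : ∀ n : ℤ, (n : ℚ) ∈ S)
    (hadd : ∀ a ∈ S, ∀ b ∈ S, a + b ∈ S) :
    ∃ d : ℕ, 0 < d ∧ S = Set.range fun n : ℤ => (n : ℚ) / d := by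
  have he' : (e : ℚ) ≠ 0 := by positivity
  have hmul (a : ℚ) (ha : a ∈ S) (n : ℕ) : n * a ∈ S := by
    induction n with
    | zero => simpa using hint 0
    | succ n ih =>
      rw [Nat.cast_succ, add_one_mul]
      exact hadd _ ih _ ha
  let G : AddSubgroup ℤ :=
    { carrier := {n | (n : ℚ) / e ∈ S}
      zero_mem' := by simpa using hint 0
      add_mem' := fun {a b} ha hb => by
        have := hadd _ ha _ hb
        rw [← add_div] at this
        simpa using this
      neg_mem' := fun {a} ha => by
        -- Negatives come from `-a / e = (e - 1) * (a / e) - a`.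
        have := hadd _ (hmul _ ha (e - 1)) _ (hint (-a))
        change ((-a : ℤ) : ℚ) / e ∈ S
        convert this using 1
        rw [Nat.cast_sub (show 1 ≤ e from he)]
        push_cast
        field_simp
        ring }
  have hG (n : ℤ) : n ∈ G ↔ (n : ℚ) / e ∈ S := Iff.rfl
  obtain ⟨g, hg⟩ := Int.subgroup_cyclic G
  rw [← AddSubgroup.zmultiples_eq_closure] at hg
  have heG : (e : ℤ) ∈ G := by
    rw [hG]
    simpa [he'] using hint 1
  rw [hg, Int.mem_zmultiples_iff] at heG
  obtain ⟨d, hd⟩ := heG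
  have hgd : (g : ℚ) * d = e := by exact_mod_cast hd.symm
  have hg0 : (g : ℚ) ≠ 0 := left_ne_zero_of_mul (hgd ▸ he')
  have hd0 : (d : ℚ) ≠ 0 := right_ne_zero_of_mul (hgd ▸ he')
  -- The generator `g` may be negative, and then so is `d = e / g`.
  refine ⟨d.natAbs, Int.natAbs_pos.2 (by exact_mod_cast hd0), ?_⟩
  have hmem (q : ℚ) : q ∈ S ↔ ∃ m : ℤ, q = m / d := by
    constructor
    · intro hq
      obtain ⟨n, rfl⟩ := hS hq
      have hn : n ∈ G := hq
      rw [hg, Int.mem_zmultiples_iff] at hn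
      obtain ⟨m, rfl⟩ := hn
      refine ⟨m, ?_⟩
      rw [← hgd]
      push_cast
      field_simp
    · rintro ⟨m, rfl⟩
      have hn : g * m ∈ G := by
        rw [hg, Int.mem_zmultiples_iff]
        exact dvd_mul_right g m
      rw [hG, ← hgd] at hn
      convert hn using 1
      push_cast
      field_simp
  ext q
  rw [hmem, Set.mem_range]
  rcases Int.natAbs_eq d with h | h
  · constructor
    · rintro ⟨m, rfl⟩
      exact ⟨m, by rw [h]; simp⟩
    · rintro ⟨m, rfl⟩
      exact ⟨m, by rw [h]; simp⟩
  · have hcast : (d : ℚ) = -(d.natAbs : ℚ) := by exact_mod_cast h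
    constructor
    · rintro ⟨m, rfl⟩
      exact ⟨-m, by rw [hcast]; push_cast; rw [div_neg, neg_div]⟩
    · rintro ⟨m, rfl⟩
      exact ⟨-m, by rw [hcast]; push_cast; rw [neg_div_neg_eq]⟩

theorem IsNormalizedDiscrete.exists_eq {K : Type*} [Field K] {vK : AddValuation K (WithTop ℚ)}
    (h : IsNormalizedDiscrete vK) (n : ℤ) :
    ∃ a : K, a ≠ 0 ∧ vK a = ((n : ℚ) : WithTop ℚ) := by
  have hn : ((n : ℚ) : WithTop ℚ) ∈ Set.range (fun n : ℤ => ((n : ℚ) : WithTop ℚ)) := ⟨n, rfl⟩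
  unfold IsNormalizedDiscrete at h
  rwa [← h] at hn

end Discrete

/-! ### The infimum on `X` and its residue field -/

namespace IsSeparating

variable {K : Type*} [Field K] {vK : AddValuation K (WithTop ℚ)}
  {v w : AddValuation K[X] (WithTop ℚ)} {φ : K[X]}

theorem inf_X_nonneg (H : IsSeparating v w φ) (hv : 0 ≤ v Polynomial.X)
    (hw : 0 ≤ w Polynomial.X) : 0 ≤ H.inf Polynomial.X := by
  have hφ0 : φ ≠ 0 := by rintro rfl; simpa using H.degree_pos
  have ha := EuclideanDomain.mod_lt (Polynomial.X : K[X]) hφ0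
  have hh : (Polynomial.X / φ : K[X]).degree < φ.degree := by
    have := Polynomial.degree_div_lt (Polynomial.X_ne_zero (R := K)) H.degree_pos
    rw [Polynomial.degree_X, Nat.WithBot.lt_one_iff_le_zero] at this
    exact this.trans_lt H.degree_pos
  have key := EuclideanDomain.mod_add_div (Polynomial.X : K[X]) φ
  generalize (Polynomial.X : K[X]) % φ = a at *
  generalize (Polynomial.X : K[X]) / φ = h at *
  rw [← key, H.inf_add_mul ha, H.inf_of_degree_lt hh, ← v.map_mul]
  -- A negative value would have to cancel against `a` for `v`; for `w` this cancellation is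
  -- impossible, which would make `w X` negative.
  have hnonneg : 0 ≤ v (φ * h) := by
    by_contra! hlt
    have hva : v a = v (φ * h) := by
      rw [eq_sub_of_add_eq key, v.map_sub_eq_of_lt_right (hlt.trans_le hv)]
    have hwlt : w a < w (φ * h) := by
      rw [← H.eq_of_degree_lt a ha, hva, v.map_mul, w.map_mul, ← H.eq_of_degree_lt h hh]
      refine WithTop.add_lt_add_right (fun htop => ?_) H.lt
      rw [v.map_mul, htop, add_top] at hlt
      exact not_top_lt hlt
    rw [← key, w.map_add_eq_of_lt_left hwlt, ← H.eq_of_degree_lt a ha, hva] at hw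
    exact not_lt.2 hw hlt
  refine le_min ?_ hnonneg
  rw [eq_sub_of_add_eq key]
  exact v.map_le_sub hv hnonneg

theorem residueTrdeg_inf (H : IsSeparating v w φ) (hv : ∀ a : K, v (Polynomial.C a) = vK a)
    (hC : ∀ a : K, H.inf (Polynomial.C a) = vK a) {n : ℕ} {c : K} (hc0 : c ≠ 0)
    (hc : vK c = (n + 1) • v φ) (h0 : H.inf.supp = ⊥) : residueTrdeg vK H.inf hC h0 = 1 := by
  unfold residueTrdeg
  have := hasExtension_extendToRatFunc vK H.inf hC h0
  have hext (f : K[X]) : extendToRatFunc H.inf h0 (algebraMap K[X] (RatFunc K) f) =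
      AddValuation.toValuation H.inf f :=
    Valuation.extendToLocalization_apply_map_apply _ _ _ f
  refine le_antisymm ((Valuation.trdeg_residueField_le _ _).trans
    (RatFunc.trdeg_eq_one K).le) (Cardinal.one_le_iff_ne_zero.2 ?_)
  rw [trdeg_ne_zero_iff]
  -- The exponent is positive, so every multiple of `s` is divisible by `φ`, and a constant added to
  -- it is its φ-adic remainder.
  set s : K[X] := Polynomial.C c⁻¹ * φ ^ (n + 1) with hs
  have hs0 : H.inf s = 0 := by
    rw [hs, H.inf.map_mul, hC, H.inf.map_pow, H.inf_self, ← hc, ← vK.map_mul, inv_mul_cancel₀ hc0,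
      vK.map_one]
  have hs1 : extendToRatFunc H.inf h0 (algebraMap K[X] (RatFunc K) s) = 1 := by
    rw [hext, AddValuation.toValuation_apply, hs0]
    rfl
  refine ⟨_, Valuation.transcendental_residue (AddValuation.toValuation vK)
    (extendToRatFunc H.inf h0) ⟨algebraMap K[X] (RatFunc K) s, hs1.le⟩ hs1 fun a P ha => ?_⟩
  have ha0 : vK a = 0 := ha
  change 1 ≤ extendToRatFunc H.inf h0 (algebraMap K (RatFunc K) a +
    algebraMap K[X] (RatFunc K) s * Polynomial.aeval (algebraMap K[X] (RatFunc K) s) P)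
  rw [Polynomial.aeval_algebraMap_apply, IsScalarTower.algebraMap_apply K K[X] (RatFunc K) a,
    ← map_mul, ← map_add, hext, ← Polynomial.C_eq_algebraMap,
    show s * Polynomial.aeval s P = φ * (Polynomial.C c⁻¹ * φ ^ n * Polynomial.aeval s P) by
      rw [hs]; ring]
  change H.inf _ ≤ 0
  rw [H.inf_add_mul (Polynomial.degree_C_le.trans_lt H.degree_pos), hv, ha0]
  exact min_le_left _ _

end IsSeparating

/-! ### Infima and rooted trees of pseudovaluations -/

namespace MacLanePseudovaluation

variable {K : Type*} [Field K] {vK : AddValuation K (WithTop ℚ)}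

theorem le_total_of_le {u₁ u₂ v : MacLanePseudovaluation vK} (h₁ : u₁ ≤ v) (h₂ : u₂ ≤ v) :
    u₁ ≤ u₂ ∨ u₂ ≤ u₁ :=
  AddValuation.le_total_of_le u₁.map_C u₂.map_C v.map_C h₁ h₂

theorem exists_isGreatest_of_isSeparating (hdisc : IsNormalizedDiscrete vK)
    {v w : MacLanePseudovaluation vK} {φ : K[X]} (H : IsSeparating v.val w.val φ) :
    ∃ u, IsGreatest (commonLowerBounds v w) u := by
  have hC (a : K) : H.inf (Polynomial.C a) = vK a := (H.inf_C a).trans (v.map_C a)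
  obtain ⟨e, he, hrange⟩ := v.discrete
  have hX : 0 ≤ H.inf Polynomial.X :=
    H.inf_X_nonneg v.map_X w.map_X
  have hdiscrete : ∃ d : ℕ, 0 < d ∧ {q : ℚ | ∃ f : K[X], H.inf f = (q : WithTop ℚ)} =
      Set.range (fun n : ℤ => (n : ℚ) / (d : ℚ)) := by
    refine exists_eq_range_div he ?_ ?_ ?_
    · rintro q ⟨f, hf⟩
      rw [← hrange]
      obtain ⟨g, hg⟩ := H.exists_inf_eq f
      exact ⟨g, by rw [← hg, hf]⟩
    · intro n
      obtain ⟨a, -, ha⟩ := hdisc.exists_eq n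
      exact ⟨Polynomial.C a, by rw [hC, ha]⟩
    · rintro a ⟨f, hf⟩ b ⟨g, hg⟩
      exact ⟨f * g, by rw [H.inf.map_mul, hf, hg, WithTop.coe_add]⟩
  have htrdeg (h0 : H.inf.supp = ⊥) : residueTrdeg vK H.inf hC h0 = 1 := by
    obtain ⟨q, hq⟩ := WithTop.ne_top_iff_exists.1 H.lt.ne_top
    obtain ⟨m, hm⟩ : q ∈ Set.range fun n : ℤ => (n : ℚ) / (e : ℚ) := hrange ▸ ⟨φ, hq.symm⟩
    obtain ⟨c, hc0, hc⟩ := hdisc.exists_eq m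
    -- From `v φ = m / e`, the power `φ ^ e` has the integral value `m`, which the constant `c` also
    -- attains.
    refine H.residueTrdeg_inf v.map_C hC (n := e - 1) hc0 ?_ h0
    have he' : (e : ℚ) ≠ 0 := by positivity
    rw [hc, ← hq, Nat.sub_add_cancel he, ← WithTop.coe_nsmul, ← hm, nsmul_eq_mul,
      mul_div_cancel₀ _ he']
  refine ⟨⟨H.inf, hC, hX, hdiscrete, htrdeg⟩, ⟨H.inf_le_left, H.inf_le_right⟩, fun u hu => ?_⟩
  exact H.le_inf (fun a => (u.map_C a).trans (v.map_C a).symm) hu.1 hu.2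

theorem exists_isGreatest (hdisc : IsNormalizedDiscrete vK) (v w : MacLanePseudovaluation vK) :
    ∃ u, IsGreatest (commonLowerBounds v w) u := by
  by_cases hne : v.val = w.val
  · obtain rfl := val_injective hne
    exact ⟨v, ⟨le_rfl, le_rfl⟩, fun u hu => hu.1⟩
  obtain ⟨φ, H | H⟩ := IsSeparating.exists_of_ne hne fun a => (v.map_C a).trans (w.map_C a).symm
  · exact exists_isGreatest_of_isSeparating hdisc H
  · obtain ⟨u, hu, hmax⟩ := exists_isGreatest_of_isSeparating hdisc H
    exact ⟨u, hu.symm, fun u' hu' => hmax hu'.symm⟩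

theorem isInf_of_isGreatest {v w u : MacLanePseudovaluation vK}
    (hu : IsGreatest (commonLowerBounds v w) u) : IsInf v w u :=
  ⟨hu.1, fun _ hu' _ => hu.2 hu'⟩

/-- Common lower bounds all lie below `v`, hence form a chain, where maximal means greatest. -/
theorem IsInf.isGreatest {v w u : MacLanePseudovaluation vK} (hu : IsInf v w u) :
    IsGreatest (commonLowerBounds v w) u := by
  refine ⟨hu.1, fun u' hu' => ?_⟩
  exact (le_total_of_le hu'.1 hu.1.1).elim id fun h => hu.2 hu' h

theorem isRootedTree (hdisc : IsNormalizedDiscrete vK) {V : Set (MacLanePseudovaluation vK)}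
    (hfin : V.Finite) (hne : V.Nonempty) (hV : IsInfClosed V) : IsRootedTree V where
  wellOrdered v _ := by
    have : Finite {w // w ∈ V ∧ w ≤ v} := hfin.subset fun _ h => h.1
    have htri : Std.Trichotomous fun a b : {w // w ∈ V ∧ w ≤ v} => a < b :=
      ⟨fun a b hab hba => by
        rcases le_total_of_le a.2.2 b.2.2 with h | h
        · exact Subtype.ext (h.eq_of_not_lt hab)
        · exact Subtype.ext (h.eq_of_not_lt hba).symm⟩
    exact { toTrichotomous := htri, toIsWellFounded := inferInstance }
  exists_root := by
    obtain ⟨r, hr⟩ := hfin.exists_minimal hne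
    refine ⟨r, hr.prop, fun w hw => ?_⟩
    obtain ⟨u, hu⟩ := exists_isGreatest hdisc r w
    exact (hr.le_of_le (hV r hr.prop w hw u (isInf_of_isGreatest hu)) hu.1.1).trans hu.1.2

end MacLanePseudovaluation

theorem proposition2 {K : Type*} [Field K] (vK : AddValuation K (WithTop ℚ))
    (hdisc : IsNormalizedDiscrete vK) (hcomplete : IsCompleteFor vK) :
    -- the elements below a given one form a chain
    (∀ v : MacLanePseudovaluation vK, IsChain (fun a b => a ≤ b) {w | w ≤ v}) ∧
    -- any two elements have a unique maximal common lower bound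
    (∀ v w : MacLanePseudovaluation vK, ∃! u, MacLanePseudovaluation.IsInf v w u) ∧
    -- and it is the greatest common lower bound
    (∀ v w u : MacLanePseudovaluation vK, MacLanePseudovaluation.IsInf v w u →
      IsGreatest (MacLanePseudovaluation.commonLowerBounds v w) u) ∧
    -- finite nonempty inf-closed sets are rooted trees
    (∀ V : Set (MacLanePseudovaluation vK), V.Finite → V.Nonempty →
      MacLanePseudovaluation.IsInfClosed V → IsRootedTree V) := by
  refine ⟨fun v a ha b hb _ => MacLanePseudovaluation.le_total_of_le ha hb, fun v w => ?_,
    fun v w u hu => hu.isGreatest,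
    fun V hfin hne hV => MacLanePseudovaluation.isRootedTree hdisc hfin hne hV⟩
  obtain ⟨u, hu⟩ := MacLanePseudovaluation.exists_isGreatest hdisc v w
  exact ⟨u, MacLanePseudovaluation.isInf_of_isGreatest hu, fun u' hu' => hu'.isGreatest.unique hu⟩
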